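/- Let $\mathbb K$ be a field, $n\ge 2$, ${\bf a}=(a_1,\dots,a_n)$ integers with all $a_i\ge 2$, and ${\bf q}=(q_{ij})\in M_n(\mathbb K)$ with $q_{ii}=1$ and $q_{ij}q_{ji}=1$ for all $i,j$. Let $$A=A({\bf q},{\bf a})=\mathbb K\langle x_1,\dots,x_n\rangle/\langle x_i^{a_i},\ x_jx_i-q_{ij}x_ix_j\rangle .$$ Put ${\bf a-1}=(a_1-1,\dots,a_n-1)$ and $V=\{{\bf v}\in\mathbb N_0^n : v_i\le a_i-1\}$. Then $A$ has the standard basis $x_{\bf v}=x_1^{v_1}\cdots x_n^{v_n}$, ${\bf v}\in V$; let $(x_{\bf v}^*)$ be the dual basis. For ${\bf u},{\bf v}\in\mathbb N_0^n$ put ${\bf q}^{\langle{\bf u}|{\bf v}\rangle}=\prod_{i<j}q_{ij}^{u_jv_i}$, and for ${\bf v}\in V$ put $h_{\bf v}={\bf q}^{\langle{\bf a-1-v}|{\bf v}\rangle}/{\bf q}^{\langle{\bf v}|{\bf a-1-v}\rangle}$. Let $\pi\in S_n$ act by $\pi({\bf v})=(v_{\pi^{-1}(1)},\dots,v_{\pi^{-1}(n)})$,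 let ${\bf e}_i$ be the $i$-th unit vector, and put $p_\pi({\bf v})=\prod_{j<k}\big({\bf q}^{\langle\pi({\bf e}_k)|\pi({\bf e}_j)\rangle}\big)^{v_jv_k}$. Call $\pi$ compatible if $a_{\pi(i)}=a_i$ and $q_{\pi(i)\pi(j)}=q_{ji}$ for all $i,j$. A bi-Frobenius algebra $(A,\phi,t,S)$ is a finite-dimensional algebra and coalgebra $A$ with $\phi\in A^*$, $t\in A$ and the linear map $S(x)=\sum\phi(t_1x)t_2$, such that the counit $\varepsilon$ is an algebra homomorphism and $1$ is group-like; every element of $A^*$ has the form $x\mapsto\phi(xy)$ for some $y\in A$, and every element of $A$ has the form $\sum f(t_1)t_2$ for some $f\in A^*$; and $S$ is both an algebra and a coalgebra anti-homomorphism. For $A=A({\bf q},{\bf a})$, $S$ is a permutation antipode if there are a permutation $\sigma$ of $V$ and scalars $c_{\bf v}\in\mathbb K$ with $S(x_{\bf v})=c_{\bf v}x_{\sigma({\bf v})}$ for all ${\bf v}\in V$. **Theorem.** Assume that $A=A({\bf q},{\bf a})$ is symmetric, i.e. $A\cong A^*$ as $A$-$A$-bimodules. Then $A$ admits a bi-Frobenius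 algebra structure with permutation antipode if and only if there is a compatible permutation $\pi\in S_n$ with $\pi^2=\mathrm{Id}$. Moreover, for every compatible $\pi\in S_n$ with $\pi^2=\mathrm{Id}$ there are $c_1,\dots,c_n\in\mathbb K$ with $c_ic_{\pi(i)}=h_{{\bf e}_i}$ for all $i$ and $p_\pi({\bf a-1})\prod_i c_i^{a_i-1}=1$, such that $(A,\ x_{\bf a-1}^*,\ x_{\bf a-1},\ S)$ is a bi-Frobenius algebra, where the coalgebra structure is given by $$\varepsilon(x_{\bf v})=\delta_{{\bf v},{\bf 0}}\ ({\bf v}\in V),\qquad \Delta(1)=1\otimes 1,\qquad \Delta(x_{\bf v})=1\otimes x_{\bf v}+x_{\bf v}\otimes 1\ \ ({\bf v}\in V\setminus\{{\bf 0},{\bf a-1}\}),$$ $$\Delta(x_{\bf a-1})=\sum_{{\bf v}\in V}g_{\bf v}\;x_{\bf a-1-v}\otimes x_{\pi({\bf v})},\qquad g_{\bf v}=\frac{1}{{\bf q}^{\langle{\bf a-1-v}|{\bf v}\rangle}}\prod_{i}c_i^{v_i}\;p_\pi({\bf v}),$$ and $S$ is given by $S(x_{\bf v})=\prod_i c_i^{v_i}\;p_\pi({\bf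 v})\;x_{\pi({\bf v})}$ for ${\bf v}\in V$; in particular $S(x_i)=c_ix_{\pi(i)}$ for $1\le i\le n$. -/

import Mathlib

open scoped TensorProduct

namespace QuantumCI

section BiFrobenius

variable (K : Type*) [Field K] {A : Type*} [Ring A] [Algebra K A]

/-- `A` is a symmetric algebra: `A ≅ A^*` as `A`-`A`-bimodules, where the bimodule structure of
the dual is `(a ⇀ f ↼ b)(y) = f (b y a)`. -/
def IsSymmetricAlgebra (A : Type*) [Ring A] [Algebra K A] : Prop :=
  ∃ e : A ≃ₗ[K] Module.Dual K A, ∀ a x b y : A, e (a * x * b) y = e x (b * y * a)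

variable {K}

/-- `(A, φ)` is a Frobenius algebra: `A^* = A ⇀ φ`, where `(a ⇀ φ)(x) = φ (x a)`. -/
def IsFrobeniusHom (φ : Module.Dual K A) : Prop :=
  ∀ f : Module.Dual K A, ∃ a : A, ∀ x : A, f x = φ (x * a)

/-- The linear map `A ⊗ A → A`, `x ⊗ y ↦ f(x) y`. -/
noncomputable def contractLeft (f : Module.Dual K A) : A ⊗[K] A →ₗ[K] A :=
  (TensorProduct.lid K A).toLinearMap ∘ₗ f.rTensor A

/-- `(A, t)` is a Frobenius coalgebra: `A = t ↼ A^*`, where `t ↼ f = ∑ f(t₁) t₂`. -/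
def IsFrobeniusCoelement [Coalgebra K A] (t : A) : Prop :=
  ∀ y : A, ∃ f : Module.Dual K A, y = contractLeft f (Coalgebra.comul (R := K) t)

/-- `(A, φ, t, S)` is a bi-Frobenius algebra. -/
structure IsBiFrobenius [Coalgebra K A] (φ : Module.Dual K A) (t : A) (S : A →ₗ[K] A) :
    Prop where
  /-- `A` is finite-dimensional. -/
  finite : Module.Finite K A
  /-- `S(x) = ∑ φ(t₁ x) t₂`. -/
  antipode_eq : ∀ x : A,
    S x = contractLeft (φ ∘ₗ LinearMap.mulRight K x) (Coalgebra.comul (R := K) t)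
  /-- The counit is an algebra homomorphism, and `1` is a group-like element. -/
  counit_one : Coalgebra.counit (R := K) (1 : A) = 1
  counit_mul : ∀ x y : A, Coalgebra.counit (R := K) (x * y) =
    Coalgebra.counit (R := K) x * Coalgebra.counit (R := K) y
  comul_one : Coalgebra.comul (R := K) (1 : A) = 1 ⊗ₜ[K] 1
  frobenius : IsFrobeniusHom φ
  coFrobenius : IsFrobeniusCoelement (K := K) t
  /-- `S` is an algebra anti-homomorphism. -/
  antipode_one : S 1 = 1
  antipode_mul : ∀ x y : A, S (x * y) = S y * S x
  /-- `S` is a coalgebra anti-homomorphism: `ε ∘ S = ε` and `Δ(S(x)) = ∑ S(x₂) ⊗ S(x₁)`. -/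
  counit_antipode : ∀ x : A, Coalgebra.counit (R := K) (S x) = Coalgebra.counit (R := K) x
  comul_antipode : ∀ x : A, Coalgebra.comul (R := K) (S x) =
    TensorProduct.map S S (TensorProduct.comm K A A (Coalgebra.comul (R := K) x))

end BiFrobenius

section Algebra

variable {K : Type*} [Field K] {n : ℕ}

/-- The defining relations `x_i ^ a_i = 0` and `x_j x_i = q_{ij} x_i x_j`. -/
inductive Rel (q : Matrix (Fin n) (Fin n) K) (a : Fin n → ℕ) :
    FreeAlgebra K (Fin n) → FreeAlgebra K (Fin n) → Prop
  | pow (i : Fin n) : Rel q a (FreeAlgebra.ι K i ^ a i) 0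
  | comm (i j : Fin n) : Rel q a (FreeAlgebra.ι K j * FreeAlgebra.ι K i)
      (q i j • (FreeAlgebra.ι K i * FreeAlgebra.ι K j))

/-- The algebra `A(q, a) = K⟨x_1, …, x_n⟩ / ⟨x_i ^ a_i, x_j x_i - q_{ij} x_i x_j⟩`. -/
abbrev Alg (q : Matrix (Fin n) (Fin n) K) (a : Fin n → ℕ) : Type _ := RingQuot (Rel q a)

/-- The generator `x_i` of `A(q, a)`. -/
noncomputable def gen (q : Matrix (Fin n) (Fin n) K) (a : Fin n → ℕ) (i : Fin n) : Alg q a :=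
  RingQuot.mkAlgHom K (Rel q a) (FreeAlgebra.ι K i)

/-- The monomial `x_v = x_1 ^ v_1 ⋯ x_n ^ v_n`, the factors multiplied in this order. -/
noncomputable def mon (q : Matrix (Fin n) (Fin n) K) (a : Fin n → ℕ) (v : Fin n → ℕ) : Alg q a :=
  (List.ofFn fun i => gen q a i ^ v i).prod

/-- The exponent vector `a - 1`. -/
def top (a : Fin n → ℕ) : Fin n → ℕ := fun i => a i - 1

/-- `V = {v ∈ ℕ^n | v_i ≤ a_i - 1 for all i}`, which indexes the standard basis. -/
def V (a : Fin n → ℕ) : Finset (Fin n → ℕ) := Finset.Iic (top a)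

/-- `e_i`. -/
def e (i : Fin n) : Fin n → ℕ := Pi.single i 1

/-- The action `π(v) = (v_{π⁻¹(1)}, …, v_{π⁻¹(n)})`. -/
def act (π : Equiv.Perm (Fin n)) (v : Fin n → ℕ) : Fin n → ℕ := fun i => v (π⁻¹ i)

/-- The structure coefficient `q^⟨u|v⟩ = ∏_{i<j} q_{ij} ^ (u_j v_i)`. -/
def qc (q : Matrix (Fin n) (Fin n) K) (u v : Fin n → ℕ) : K :=
  ∏ j : Fin n, ∏ i ∈ Finset.Iio j, q i j ^ (u j * v i)

/-- `h_v = q^⟨a-1-v|v⟩ / q^⟨v|a-1-v⟩`, for `v ∈ V`. -/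
def h (q : Matrix (Fin n) (Fin n) K) (a : Fin n → ℕ) (v : Fin n → ℕ) : K :=
  qc q (top a - v) v / qc q v (top a - v)

/-- `∏_{j<k} (q^⟨π(e_k)|π(e_j)⟩) ^ (v_j v_k)`. -/
def permCoeff (q : Matrix (Fin n) (Fin n) K) (π : Equiv.Perm (Fin n)) (v : Fin n → ℕ) : K :=
  ∏ k : Fin n, ∏ j ∈ Finset.Iio k, qc q (act π (e k)) (act π (e j)) ^ (v j * v k)

/-- `π` is a compatible permutation. -/
def IsCompatible (q : Matrix (Fin n) (Fin n) K) (a : Fin n → ℕ) (π : Equiv.Perm (Fin n)) : Prop :=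
  (∀ i, a (π i) = a i) ∧ ∀ i j, q (π i) (π j) = q j i

/-- `S` acts on the standard basis by scalars up to a permutation of `V`. -/
def IsPermutationAntipode (q : Matrix (Fin n) (Fin n) K) (a : Fin n → ℕ)
    (S : Alg q a →ₗ[K] Alg q a) : Prop :=
  ∃ (σ : Equiv.Perm (V a)) (c : V a → K), ∀ v : V a, S (mon q a v) = c v • mon q a (σ v)

/-- `A(q, a)` admits a bi-Frobenius algebra structure with permutation antipode. -/
def AdmitsPermutationBiFrobenius (q : Matrix (Fin n) (Fin n) K) (a : Fin n → ℕ) : Prop :=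
  ∃ (_ : Coalgebra K (Alg q a)) (φ : Module.Dual K (Alg q a)) (t : Alg q a)
    (S : Alg q a →ₗ[K] Alg q a), IsBiFrobenius φ t S ∧ IsPermutationAntipode q a S

/-- The scalar `g_{a-1-v, π(v)}`, for `v ∈ V`. -/
def g (q : Matrix (Fin n) (Fin n) K) (a : Fin n → ℕ) (π : Equiv.Perm (Fin n)) (c : Fin n → K)
    (v : Fin n → ℕ) : K :=
  (1 / qc q (top a - v) v) * (∏ i, c i ^ v i) * permCoeff q π v

/-- `φ = x_{a-1}^*`, the element at `a - 1` of the basis dual to the standard basis. -/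
def IsDualTop (q : Matrix (Fin n) (Fin n) K) (a : Fin n → ℕ) (φ : Module.Dual K (Alg q a)) : Prop :=
  ∀ v ∈ V a, φ (mon q a v) = if v = top a then 1 else 0

/-- The counit and the comultiplication are the explicit ones attached to `π` and `c`, given by
their values on the standard basis. -/
structure IsExplicitCoalgebra (q : Matrix (Fin n) (Fin n) K) (a : Fin n → ℕ)
    (π : Equiv.Perm (Fin n)) (c : Fin n → K) [Coalgebra K (Alg q a)] : Prop where
  counit_mon : ∀ v ∈ V a, Coalgebra.counit (R := K) (mon q a v) = if v = 0 then 1 else 0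
  comul_one : Coalgebra.comul (R := K) (1 : Alg q a) = 1 ⊗ₜ[K] 1
  comul_mon : ∀ v ∈ V a, v ≠ 0 → v ≠ top a →
    Coalgebra.comul (R := K) (mon q a v) = 1 ⊗ₜ[K] mon q a v + mon q a v ⊗ₜ[K] 1
  comul_top : Coalgebra.comul (R := K) (mon q a (top a)) =
    ∑ v ∈ V a, g q a π c v • (mon q a (top a - v) ⊗ₜ[K] mon q a (act π v))

/-- `S` is the explicit antipode attached to `π` and `c`, given by its values on the standard
basis. -/
def IsExplicitAntipode (q : Matrix (Fin n) (Fin n) K) (a : Fin n → ℕ)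
    (π : Equiv.Perm (Fin n)) (c : Fin n → K) (S : Alg q a →ₗ[K] Alg q a) : Prop :=
  ∀ v ∈ V a, S (mon q a v) = ((∏ i, c i ^ v i) * permCoeff q π v) • mon q a (act π v)

end Algebra

end QuantumCI

/-! Symmetry of `A` enters through a nondegenerate trace form `ψ`. The top monomial spans a
one-dimensional ideal on which `ψ` does not vanish, so comparing `ψ (x * y)` with `ψ (y * x)` on
complementary monomials makes every `h` on `V` equal to 1 (`h_eq_one`).

Given a compatible involution `π`, sending `x_i` to `c_i x_{π(i)}` respects the relations up to
reversal, hence defines an anti-endomorphism `S`; it is an involution once `c_i c_{π(i)} = 1`. Every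
monomial other than 1 and the top one is declared primitive. The extra terms of the comultiplication
of the top monomial then involve primitive elements only, which gives coassociativity. These terms
are chosen so that contraction against the form of `x_{a-1}^*` returns `S`. Compatibility of `S`
with the comultiplication reduces to `S² = id`, the symmetry of the coefficients, and `S` fixing the
top monomial. A sign argument finds scalars achieving the last condition
(`exists_antipode_scalars`).

Conversely, `S` is bijective and preserves the counit, hence also the square of the augmentation
ideal, so a permutation antipode permutes the generators up to scalars. Nilpotency orders and
commutation relations make this permutation compatible. On a symmetric algebra `S²` is inner up to
an element `u` with nonzero counit (`exists_mul_eq_mul_antipode_antipode`), so modulo the square of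
the augmentation ideal `S²` is the identity, and the permutation is an involution. -/

namespace QuantumCI

/-! ### The monomial basis and its multiplication. -/

section Basis

variable {K : Type*} [Field K] {n : ℕ} {q : Matrix (Fin n) (Fin n) K} {a : Fin n → ℕ}

/-- Matches the fact that `x_{v+e_i}` is a nonzero multiple of `x_i x_v`. -/
theorem exponent_induction {P : (Fin n → ℕ) → Prop} (zero : P 0)
    (add : ∀ v i, P v → P (v + e i)) (v : Fin n → ℕ) : P v := by
  induction hs : ∑ i, v i generalizing v with
  | zero =>
    have : v = 0 := by
      funext i
      have := (Finset.sum_eq_zero_iff.1 hs) i (Finset.mem_univ i)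
      simpa using this
    rwa [this]
  | succ k ih =>
    obtain ⟨i, hi⟩ : ∃ i, v i ≠ 0 := by
      by_contra! hc
      simp [hc] at hs
    have hv : v = (v - e i) + e i := by
      funext j
      rcases eq_or_ne j i with rfl | hj
      · simp [e]; omega
      · simp [e, hj]
    rw [hv]
    refine add _ _ (ih _ ?_)
    rw [hv] at hs
    simp only [Pi.add_apply, Finset.sum_add_distrib] at hs
    simpa [e] using hs

theorem exists_eq_add_e {v : Fin n → ℕ} (hv : v ≠ 0) : ∃ w i, v = w + e i := by
  induction v using exponent_induction with
  | zero => exact absurd rfl hv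
  | add v i _ => exact ⟨v, i, rfl⟩

theorem qc_add_left (u u' v : Fin n → ℕ) : qc q (u + u') v = qc q u v * qc q u' v := by
  simp only [qc, ← Finset.prod_mul_distrib, Pi.add_apply, add_mul, pow_add]

theorem qc_add_right (u v v' : Fin n → ℕ) : qc q u (v + v') = qc q u v * qc q u v' := by
  simp only [qc, ← Finset.prod_mul_distrib, Pi.add_apply, mul_add, pow_add]

@[simp] theorem qc_zero_left (v : Fin n → ℕ) : qc q 0 v = 1 := by simp [qc]

@[simp] theorem qc_zero_right (v : Fin n → ℕ) : qc q v 0 = 1 := by simp [qc]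

theorem qc_ne_zero (hq : ∀ i j, q i j * q j i = 1) (u v : Fin n → ℕ) : qc q u v ≠ 0 :=
  Finset.prod_ne_zero_iff.2 fun j _ => Finset.prod_ne_zero_iff.2 fun i _ =>
    pow_ne_zero _ (left_ne_zero_of_mul_eq_one (hq i j))

theorem qc_e_left (i : Fin n) (v : Fin n → ℕ) :
    qc q (e i) v = ∏ k, if k < i then q k i ^ v k else 1 := by
  rw [qc, Finset.prod_eq_single i]
  · rw [← Finset.prod_filter]
    refine Finset.prod_congr (by ext; simp) fun k _ => by simp [e]
  · intro j _ hj
    simp [e, hj]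
  · simp

theorem qc_e_e (i j : Fin n) : qc q (e j) (e i) = if i < j then q i j else 1 := by
  rw [qc_e_left, Finset.prod_eq_single i]
  · simp [e]
  · intro k _ hk
    simp [e, hk]
  · simp

theorem gen_pow (i : Fin n) : gen q a i ^ a i = 0 := by
  have := RingQuot.mkAlgHom_rel K (Rel.pow (q := q) (a := a) i)
  simpa [gen] using this

theorem gen_mul_gen (i j : Fin n) :
    gen q a j * gen q a i = q i j • (gen q a i * gen q a j) := by
  have := RingQuot.mkAlgHom_rel K (Rel.comm (q := q) (a := a) i j)
  simpa [gen] using this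

@[simp] theorem mon_zero : mon q a 0 = 1 := by simp [mon]

theorem mul_pow_of_mul_eq_smul {B : Type*} [Ring B] [Algebra K B] {x y : B} {c : K}
    (h : y * x = c • (x * y)) (k : ℕ) : y * x ^ k = c ^ k • (x ^ k * y) := by
  induction k with
  | zero => simp
  | succ k ih =>
    rw [pow_succ, ← mul_assoc, ih, smul_mul_assoc, mul_assoc, h, mul_smul_comm, smul_smul,
      pow_succ, mul_assoc]

theorem mul_ordered_prod {B : Type*} [Ring B] [Algebra K B] {m : ℕ} (r : Fin m → Fin m → K)
    (x : Fin m → B) (h : ∀ i j, x j * x i = r i j • (x i * x j)) (v : Fin m → ℕ) (i : Fin m) :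
    x i * (List.ofFn fun k => x k ^ v k).prod =
      (∏ k, if k < i then r k i ^ v k else 1) •
        (List.ofFn fun k => x k ^ (v k + (Pi.single i 1 : Fin m → ℕ) k)).prod := by
  induction m with
  | zero => exact i.elim0
  | succ m ih =>
    rw [List.ofFn_succ, List.ofFn_succ, List.prod_cons, List.prod_cons, Fin.prod_univ_succ]
    -- The first generator joins the leading power; any other one moves past that power and enters
    -- the shorter product.
    refine Fin.cases ?_ (fun j => ?_) i
    · simp [pow_succ', mul_assoc]
    · have := ih (fun i j => r i.succ j.succ) (fun i => x i.succ) (fun i j => h _ _)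
        (fun i => v i.succ) j
      rw [← mul_assoc, mul_pow_of_mul_eq_smul (h 0 j.succ), smul_mul_assoc, mul_assoc, this]
      have hs : ∀ k : Fin m, (Pi.single j.succ 1 : Fin (m + 1) → ℕ) k.succ
          = (Pi.single j 1 : Fin m → ℕ) k := fun k => by
        simp [Pi.single_apply]
      simp [hs, smul_smul, Fin.succ_lt_succ_iff]

theorem gen_mul_mon (i : Fin n) (v : Fin n → ℕ) :
    gen q a i * mon q a v = qc q (e i) v • mon q a (v + e i) := by
  rw [qc_e_left]
  exact mul_ordered_prod (fun i j => q i j) (gen q a) (fun i j => gen_mul_gen i j) v i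

theorem mon_e (i : Fin n) : mon q a (e i) = gen q a i := by
  have := gen_mul_mon (q := q) (a := a) i 0
  simpa using this.symm

theorem mon_add_e (hq : ∀ i j, q i j * q j i = 1) (v : Fin n → ℕ) (i : Fin n) :
    mon q a (v + e i) = (qc q (e i) v)⁻¹ • (gen q a i * mon q a v) := by
  rw [gen_mul_mon, smul_smul, inv_mul_cancel₀ (qc_ne_zero hq _ _), one_smul]

theorem mon_mul_mon (hq : ∀ i j, q i j * q j i = 1) (u v : Fin n → ℕ) :
    mon q a u * mon q a v = qc q u v • mon q a (u + v) := by
  induction u using exponent_induction with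
  | zero => simp
  | add u i ih =>
    rw [mon_add_e hq, smul_mul_assoc, mul_assoc, ih, mul_smul_comm, gen_mul_mon, smul_smul,
      smul_smul, qc_add_left, qc_add_right, add_right_comm]
    congr 1
    field_simp [qc_ne_zero hq (e i) u]

theorem mem_V {v : Fin n → ℕ} : v ∈ V a ↔ v ≤ top a := Finset.mem_Iic

theorem mon_eq_zero {v : Fin n → ℕ} (hv : ¬ v ≤ top a) : mon q a v = 0 := by
  obtain ⟨i, hi⟩ : ∃ i, top a i < v i := by simpa [Pi.le_def] using hv
  refine List.prod_eq_zero (List.mem_ofFn.2 ⟨i, ?_⟩)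
  exact pow_eq_zero_of_le (by simp only [top] at hi; omega) (gen_pow i)

@[elab_as_elim]
theorem Alg.induction {P : Alg q a → Prop} (algebraMap : ∀ r, P (algebraMap K _ r))
    (gen : ∀ i, P (gen q a i)) (mul : ∀ x y, P x → P y → P (x * y))
    (add : ∀ x y, P x → P y → P (x + y)) (x : Alg q a) : P x := by
  obtain ⟨x, rfl⟩ := RingQuot.mkAlgHom_surjective K (Rel q a) x
  induction x using FreeAlgebra.induction with
  | grade0 r => simpa using algebraMap r
  | grade1 i => exact gen i
  | mul x y hx hy => simpa using mul _ _ hx hy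
  | add x y hx hy => simpa using add _ _ hx hy

/-- The span is stable under left multiplication by generators, so it is a left ideal, and it
contains 1. -/
theorem span_mon : Submodule.span K (Set.range fun v : V a => mon q a v) = ⊤ := by
  set M := Submodule.span K (Set.range fun v : V a => mon q a v) with hM
  have hmon : ∀ v, mon q a v ∈ M := fun v => by
    by_cases hv : v ≤ top a
    · exact Submodule.subset_span ⟨⟨v, mem_V.2 hv⟩, rfl⟩
    · rw [mon_eq_zero hv]; exact zero_mem _
  have key : ∀ x y : Alg q a, y ∈ M → x * y ∈ M := by
    intro x
    induction x using Alg.induction with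
    | algebraMap r => intro y hy; rw [← Algebra.smul_def]; exact M.smul_mem r hy
    | gen i =>
      intro y hy
      induction hy using Submodule.span_induction with
      | mem y hy =>
        obtain ⟨v, rfl⟩ := hy
        simp only [gen_mul_mon]
        exact M.smul_mem _ (hmon _)
      | zero => simp
      | add y z _ _ h1 h2 => rw [mul_add]; exact add_mem h1 h2
      | smul r y _ h => rw [mul_smul_comm]; exact M.smul_mem _ h
    | mul x y hx hy => intro z hz; rw [mul_assoc]; exact hx _ (hy _ hz)
    | add x y hx hy => intro z hz; rw [add_mul]; exact add_mem (hx _ hz) (hy _ hz)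
  rw [eq_top_iff]
  intro x _
  simpa using key x 1 (by simpa using hmon 0)

/-- The operator on the span of all exponent vectors which represents `x_i`. -/
noncomputable def shift (q : Matrix (Fin n) (Fin n) K) (a : Fin n → ℕ) (i : Fin n) :
    Module.End K ((Fin n → ℕ) →₀ K) := by
  classical
  exact Finsupp.linearCombination K fun v =>
    if v + e i ≤ top a then Finsupp.single (v + e i) (qc q (e i) v) else 0

open Classical in
theorem shift_single (i : Fin n) (v : Fin n → ℕ) (r : K) :
    shift q a i (Finsupp.single v r) =
      if v + e i ≤ top a then Finsupp.single (v + e i) (r * qc q (e i) v) else 0 := by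
  simp [shift]

/-- Truncation happens only when a shift is applied, so an exponent already outside `V` is not
killed by the zeroth power; hence `k ≠ 0`. -/
theorem shift_pow (i : Fin n) {k : ℕ} (hk : k ≠ 0) {v : Fin n → ℕ} (hv : a i ≤ v i + k) (r : K) :
    (shift q a i ^ k) (Finsupp.single v r) = 0 := by
  induction k generalizing v r with
  | zero => exact absurd rfl hk
  | succ k ih =>
    rw [pow_succ, Module.End.mul_apply, shift_single]
    split_ifs with h
    · have h1 := h i
      simp only [Pi.add_apply, e, Pi.single_eq_same, top] at h1
      refine ih (by omega) ?_ _
      simp only [Pi.add_apply, e, Pi.single_eq_same]; omega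
    · simp

theorem le_of_add_le {u v w : Fin n → ℕ} (h : u + v ≤ w) : u ≤ w :=
  le_trans (le_add_of_nonneg_right zero_le) h

theorem shift_mul_shift (hd : ∀ i, q i i = 1) (hq : ∀ i j, q i j * q j i = 1) (i j : Fin n) :
    shift q a j * shift q a i = q i j • (shift q a i * shift q a j) := by
  refine Finsupp.lhom_ext fun v r => ?_
  rw [LinearMap.smul_apply, Module.End.mul_apply, Module.End.mul_apply, shift_single, shift_single]
  by_cases h : v + e i + e j ≤ top a
  · have h' : v + e j + e i ≤ top a := by rwa [add_right_comm]
    rw [if_pos (le_of_add_le h), if_pos (le_of_add_le h'), shift_single, shift_single, if_pos h,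
      if_pos h', add_right_comm v (e j), Finsupp.smul_single, qc_add_right, qc_add_right, qc_e_e,
      qc_e_e]
    congr 1
    rcases lt_trichotomy i j with hij | rfl | hij
    · simp [hij, hij.not_gt]; ring
    · simp [hd]
    · simp only [hij, hij.not_gt, if_true, if_false, smul_eq_mul]
      linear_combination (-r * qc q (e i) v * qc q (e j) v) * hq i j
  · have h' : ¬ v + e j + e i ≤ top a := by rwa [add_right_comm]
    split_ifs <;> simp only [shift_single, h, h', if_false, map_zero, smul_zero]

/-- The representation of `A(q, a)` by the operators `shift q a i`. -/
noncomputable def shiftRep (ha : ∀ i, a i ≠ 0) (hd : ∀ i, q i i = 1)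
    (hq : ∀ i j, q i j * q j i = 1) : Alg q a →ₐ[K] Module.End K ((Fin n → ℕ) →₀ K) :=
  RingQuot.liftAlgHom K ⟨FreeAlgebra.lift K (shift q a), fun x y hxy => by
    cases hxy with
    | pow i =>
      simp only [map_pow, FreeAlgebra.lift_ι_apply, map_zero]
      exact Finsupp.lhom_ext fun v r => by rw [shift_pow i (ha i) (by omega)]; simp
    | comm i j =>
      simp only [map_mul, map_smul, FreeAlgebra.lift_ι_apply]
      exact shift_mul_shift hd hq i j⟩

theorem shiftRep_gen (ha : ∀ i, a i ≠ 0) (hd : ∀ i, q i i = 1)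
    (hq : ∀ i j, q i j * q j i = 1) (i : Fin n) :
    shiftRep ha hd hq (gen q a i) = shift q a i := by
  rw [shiftRep, gen, RingQuot.liftAlgHom_mkAlgHom_apply, FreeAlgebra.lift_ι_apply]

theorem shiftRep_mon (ha : ∀ i, a i ≠ 0) (hd : ∀ i, q i i = 1)
    (hq : ∀ i j, q i j * q j i = 1) {v : Fin n → ℕ} (hv : v ≤ top a) :
    shiftRep ha hd hq (mon q a v) (Finsupp.single 0 1) = Finsupp.single v 1 := by
  induction v using exponent_induction with
  | zero => simp
  | add v i ih =>
    rw [mon_add_e hq, map_smul, map_mul, LinearMap.smul_apply, Module.End.mul_apply,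
      ih (le_of_add_le hv), shiftRep_gen, shift_single, if_pos hv, Finsupp.smul_single]
    simp [qc_ne_zero hq]

/-- In the shift representation the monomials send the vector at exponent 0 to distinct basis
vectors. -/
theorem linearIndependent_mon (ha : ∀ i, a i ≠ 0) (hd : ∀ i, q i i = 1)
    (hq : ∀ i j, q i j * q j i = 1) : LinearIndependent K fun v : V a => mon q a v := by
  refine LinearIndependent.of_comp
    ((LinearMap.applyₗ (Finsupp.single 0 1)).comp (shiftRep ha hd hq).toLinearMap) ?_
  have h1 : LinearIndependent K fun v : Fin n → ℕ => (Finsupp.single v 1 : (Fin n → ℕ) →₀ K) := by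
    simpa using (Finsupp.basisSingleOne (R := K) (ι := Fin n → ℕ)).linearIndependent
  have h2 := h1.comp (fun v : V a => (v : Fin n → ℕ)) Subtype.val_injective
  convert h2 using 1
  funext v
  simpa using shiftRep_mon ha hd hq (mem_V.1 v.2)

/-- The standard basis of `A(q, a)`. -/
noncomputable def monBasis (ha : ∀ i, a i ≠ 0) (hd : ∀ i, q i i = 1)
    (hq : ∀ i j, q i j * q j i = 1) : Module.Basis (V a) K (Alg q a) :=
  Module.Basis.mk (linearIndependent_mon ha hd hq) span_mon.ge

theorem monBasis_apply (ha : ∀ i, a i ≠ 0) (hd : ∀ i, q i i = 1)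
    (hq : ∀ i j, q i j * q j i = 1) (v : V a) : monBasis ha hd hq v = mon q a v := by
  simp [monBasis]

theorem mon_ne_zero (ha : ∀ i, a i ≠ 0) (hd : ∀ i, q i i = 1)
    (hq : ∀ i j, q i j * q j i = 1) {v : Fin n → ℕ} (hv : v ≤ top a) : mon q a v ≠ 0 := by
  have := (monBasis ha hd hq).ne_zero ⟨v, mem_V.2 hv⟩
  rwa [monBasis_apply] at this

theorem linearMap_ext_mon {M : Type*} [AddCommMonoid M] [Module K M] {f f' : Alg q a →ₗ[K] M}
    (h : ∀ v ∈ V a, f (mon q a v) = f' (mon q a v)) : f = f' :=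
  LinearMap.ext_on_range (v := fun v : V a => mon q a v) span_mon fun v => h v v.2

end Basis

/-! ### Coalgebras in which only one basis direction fails to be primitive. -/

section AlmostPrimitive

variable {K A ι : Type*} [Field K] [Ring A] [Algebra K A]

/-- The map `x ↦ 1 ⊗ x + x ⊗ 1 - ε(x) 1 ⊗ 1 + τ(x) ∑ u_i ⊗ w_i`. -/
noncomputable def almostPrimitiveComul (ε τ : Module.Dual K A) (s : Finset ι) (u w : ι → A) :
    A →ₗ[K] A ⊗[K] A :=
  TensorProduct.mk K A A 1 + (TensorProduct.mk K A A).flip 1 - ε.smulRight (1 ⊗ₜ 1) +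
    τ.smulRight (∑ i ∈ s, u i ⊗ₜ w i)

theorem almostPrimitiveComul_apply (ε τ : Module.Dual K A) (s : Finset ι) (u w : ι → A) (x : A) :
    almostPrimitiveComul ε τ s u w x =
      1 ⊗ₜ x + x ⊗ₜ 1 - ε x • (1 ⊗ₜ 1) + τ x • ∑ i ∈ s, u i ⊗ₜ w i := by
  simp [almostPrimitiveComul]

/-- The coalgebra with comultiplication `almostPrimitiveComul` and counit `ε`. -/
@[reducible] noncomputable def almostPrimitiveCoalgebra (ε τ : Module.Dual K A) (s : Finset ι)
    (u w : ι → A) (hε : ε 1 = 1) (hτ : τ 1 = 0) (hεu : ∀ i ∈ s, ε (u i) = 0)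
    (hεw : ∀ i ∈ s, ε (w i) = 0) (hτu : ∀ i ∈ s, τ (u i) = 0) (hτw : ∀ i ∈ s, τ (w i) = 0) :
    Coalgebra K A where
  comul := almostPrimitiveComul ε τ s u w
  counit := ε
  coassoc := by
    -- The unit is group-like and all `u_i`, `w_i` are primitive, so both iterated coproducts of `∑
    -- u_i ⊗ w_i` are explicit.
    have h1 : almostPrimitiveComul ε τ s u w 1 = 1 ⊗ₜ 1 := by
      simp [almostPrimitiveComul_apply, hε, hτ]
    have hu : ∀ i ∈ s, almostPrimitiveComul ε τ s u w (u i) = 1 ⊗ₜ u i + u i ⊗ₜ 1 := fun i hi => by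
      simp [almostPrimitiveComul_apply, hεu i hi, hτu i hi]
    have hw : ∀ i ∈ s, almostPrimitiveComul ε τ s u w (w i) = 1 ⊗ₜ w i + w i ⊗ₜ 1 := fun i hi => by
      simp [almostPrimitiveComul_apply, hεw i hi, hτw i hi]
    have hM1 : (TensorProduct.assoc K A A A) ((almostPrimitiveComul ε τ s u w).rTensor A
        (∑ i ∈ s, u i ⊗ₜ w i)) = ∑ i ∈ s, 1 ⊗ₜ (u i ⊗ₜ w i) + ∑ i ∈ s, u i ⊗ₜ (1 ⊗ₜ w i) := by
      rw [map_sum, map_sum, ← Finset.sum_add_distrib]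
      refine Finset.sum_congr rfl fun i hi => ?_
      rw [LinearMap.rTensor_tmul, hu i hi, TensorProduct.add_tmul, map_add]
      simp
    have hM2 : (almostPrimitiveComul ε τ s u w).lTensor A (∑ i ∈ s, u i ⊗ₜ w i) =
        ∑ i ∈ s, u i ⊗ₜ (1 ⊗ₜ w i) + ∑ i ∈ s, u i ⊗ₜ (w i ⊗ₜ 1) := by
      rw [map_sum, ← Finset.sum_add_distrib]
      refine Finset.sum_congr rfl fun i hi => ?_
      rw [LinearMap.lTensor_tmul, hw i hi, TensorProduct.tmul_add]
    ext x
    simp only [LinearMap.comp_apply, LinearEquiv.coe_coe]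
    conv_lhs => rw [almostPrimitiveComul_apply]
    conv_rhs => rw [almostPrimitiveComul_apply]
    simp only [map_add, map_sub, map_smul, hM1, hM2, LinearMap.rTensor_tmul,
      LinearMap.lTensor_tmul, h1]
    rw [almostPrimitiveComul_apply]
    simp only [TensorProduct.add_tmul, TensorProduct.sub_tmul, TensorProduct.tmul_add,
      TensorProduct.tmul_sub, ← TensorProduct.smul_tmul', TensorProduct.tmul_smul,
      TensorProduct.sum_tmul, TensorProduct.tmul_sum, map_add, map_sub, map_smul, map_sum,
      TensorProduct.assoc_tmul, smul_add]
    abel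
  rTensor_counit_comp_comul := by
    ext x
    have : (ε.rTensor A) (∑ i ∈ s, u i ⊗ₜ w i) = 0 := by
      rw [map_sum]
      exact Finset.sum_eq_zero fun i hi => by simp [hεu i hi]
    simp only [LinearMap.comp_apply, almostPrimitiveComul_apply, map_add, map_sub, map_smul, this]
    simp [hε, TensorProduct.smul_tmul']
  lTensor_counit_comp_comul := by
    ext x
    have : (ε.lTensor A) (∑ i ∈ s, u i ⊗ₜ w i) = 0 := by
      rw [map_sum]
      exact Finset.sum_eq_zero fun i hi => by simp [hεw i hi]
    simp only [LinearMap.comp_apply, almostPrimitiveComul_apply, map_add, map_sub, map_smul, this]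
    simp [hε, ← TensorProduct.tmul_smul]

end AlmostPrimitive

/-! ### Consequences of the symmetry of the algebra. -/

section Symmetric

/-- The form is the image of 1 under the bimodule isomorphism. -/
theorem IsSymmetricAlgebra.exists_form {K A : Type*} [Field K] [Ring A] [Algebra K A]
    (hA : IsSymmetricAlgebra K A) : ∃ ψ : Module.Dual K A, (∀ x y, ψ (x * y) = ψ (y * x)) ∧
      (∀ f : Module.Dual K A, ∃ u, ∀ y, f y = ψ (y * u)) ∧ ∀ x, (∀ y, ψ (x * y) = 0) → x = 0 := by
  obtain ⟨E, hE⟩ := hA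
  have h1 : ∀ x y, E x y = E 1 (y * x) := fun x y => by simpa using hE x 1 1 y
  have h2 : ∀ x y, E x y = E 1 (x * y) := fun x y => by simpa using hE 1 1 x y
  refine ⟨E 1, fun x y => by rw [← h1, ← h2], fun f => ⟨E.symm f, fun y => ?_⟩, fun x hx => ?_⟩
  · rw [← h1, E.apply_symm_apply]
  · exact E.map_eq_zero_iff.1 (LinearMap.ext fun y => by rw [h2, hx]; rfl)

variable {K : Type*} [Field K] {n : ℕ} {q : Matrix (Fin n) (Fin n) K} {a : Fin n → ℕ}

/-- The algebra homomorphism `A(q, a) → K` which maps all `x_i` to `0`. -/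
noncomputable def aug (q : Matrix (Fin n) (Fin n) K) (ha : ∀ i, a i ≠ 0) : Alg q a →ₐ[K] K :=
  RingQuot.liftAlgHom K ⟨FreeAlgebra.lift K fun _ => 0, fun x y hxy => by
    cases hxy with
    | pow i => simp [ha i]
    | comm i j => simp⟩

theorem aug_gen (ha : ∀ i, a i ≠ 0) (i : Fin n) : aug q ha (gen q a i) = 0 := by
  rw [aug, gen, RingQuot.liftAlgHom_mkAlgHom_apply, FreeAlgebra.lift_ι_apply]

theorem algHom_mon_eq_zero (hq : ∀ i j, q i j * q j i = 1) {ε : Alg q a →ₐ[K] K}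
    (hε : ∀ i, ε (gen q a i) = 0) {v : Fin n → ℕ} (hv : v ≠ 0) : ε (mon q a v) = 0 := by
  obtain ⟨w, i, rfl⟩ := exists_eq_add_e hv
  simp [mon_add_e hq, hε]

theorem algHom_mon (hq : ∀ i j, q i j * q j i = 1) {ε : Alg q a →ₐ[K] K}
    (hε : ∀ i, ε (gen q a i) = 0) (v : Fin n → ℕ) :
    ε (mon q a v) = if v = 0 then 1 else 0 := by
  split_ifs with h
  · simp [h]
  · exact algHom_mon_eq_zero hq hε h

theorem not_top_add_le {v : Fin n → ℕ} (hv : v ≠ 0) : ¬ top a + v ≤ top a := by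
  rwa [add_le_iff_nonpos_right, nonpos_iff_eq_zero]

theorem mon_top_mul (hq : ∀ i j, q i j * q j i = 1) {ε : Alg q a →ₐ[K] K}
    (hε : ∀ i, ε (gen q a i) = 0) (y : Alg q a) :
    mon q a (top a) * y = ε y • mon q a (top a) := by
  suffices h : LinearMap.mulLeft K (mon q a (top a)) =
      ε.toLinearMap.smulRight (mon q a (top a)) from LinearMap.congr_fun h y
  refine linearMap_ext_mon fun v _ => ?_
  simp only [LinearMap.mulLeft_apply, LinearMap.smulRight_apply, AlgHom.toLinearMap_apply,
    algHom_mon hq hε]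
  split_ifs with h
  · simp [h]
  · rw [mon_mul_mon hq, mon_eq_zero (not_top_add_le h)]; simp

/-- Both products of complementary monomials are multiples of the top monomial, and a trace form
does not see their order. -/
theorem qc_top_sub (ha : ∀ i, a i ≠ 0) (hd : ∀ i, q i i = 1) (hq : ∀ i j, q i j * q j i = 1)
    (hA : IsSymmetricAlgebra K (Alg q a)) {v : Fin n → ℕ} (hv : v ≤ top a) :
    qc q (top a - v) v = qc q v (top a - v) := by
  obtain ⟨ψ, hψ, -, hnd⟩ := hA.exists_form
  have h0 : ψ (mon q a (top a)) ≠ 0 := fun h0 => mon_ne_zero ha hd hq le_rfl <|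
    hnd (mon q a (top a)) fun y => by rw [mon_top_mul hq (aug_gen ha), map_smul, h0, smul_zero]
  have := hψ (mon q a (top a - v)) (mon q a v)
  rw [mon_mul_mon hq, mon_mul_mon hq, tsub_add_cancel_of_le hv, add_tsub_cancel_of_le hv, map_smul,
    map_smul] at this
  exact mul_right_cancel₀ h0 this

theorem h_eq_one (ha : ∀ i, a i ≠ 0) (hd : ∀ i, q i i = 1) (hq : ∀ i j, q i j * q j i = 1)
    (hA : IsSymmetricAlgebra K (Alg q a)) {v : Fin n → ℕ} (hv : v ≤ top a) : h q a v = 1 := by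
  rw [h, qc_top_sub ha hd hq hA hv, div_self (qc_ne_zero hq _ _)]

theorem e_le_top (ha : ∀ i, 2 ≤ a i) (i : Fin n) : e i ≤ top a := by
  intro j
  have := ha j
  rcases eq_or_ne j i with rfl | hj
  · simp [e, top]; omega
  · simp [e, hj]

end Symmetric

/-! ### The anti-endomorphism attached to a compatible permutation, and its scalars. -/

section Antipode

variable {K : Type*} [Field K] {n : ℕ} {q : Matrix (Fin n) (Fin n) K} {a : Fin n → ℕ}
  {π : Equiv.Perm (Fin n)}

@[simp] theorem act_zero : act π (0 : Fin n → ℕ) = 0 := rfl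

theorem act_add (u v : Fin n → ℕ) : act π (u + v) = act π u + act π v := rfl

theorem act_e (i : Fin n) : act π (e i) = e (π i) := by
  funext j
  simp [act, e, Pi.single_apply, Equiv.symm_apply_eq]

theorem act_act (hπ : π ^ 2 = 1) (v : Fin n → ℕ) : act π (act π v) = v := by
  have : π⁻¹ * π⁻¹ = 1 := by rw [← mul_inv_rev, ← sq, hπ, inv_one]
  funext i
  exact congrArg v (Equiv.congr_fun this i)

theorem act_injective : Function.Injective (act π) := fun u v h => by
  funext i
  simpa [act] using congrFun h (π i)

theorem act_top (hc : IsCompatible q a π) : act π (top a) = top a := by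
  funext i
  have := hc.1 (π⁻¹ i)
  rw [show π (π⁻¹ i) = i from π.apply_symm_apply i] at this
  simp only [act, top, this]

theorem act_le_top (hc : IsCompatible q a π) {v : Fin n → ℕ} (hv : v ≤ top a) :
    act π v ≤ top a := by
  rw [← act_top hc]
  exact fun i => hv _

theorem act_eq_zero_iff {v : Fin n → ℕ} : act π v = 0 ↔ v = 0 := act_injective.eq_iff' act_zero

theorem act_eq_top_iff (hc : IsCompatible q a π) {v : Fin n → ℕ} : act π v = top a ↔ v = top a :=
  act_injective.eq_iff' (act_top hc)

/-- The homomorphism from `A(q, a)` to its opposite algebra given by `x_i ↦ c_i x_{π(i)}`. -/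
noncomputable def antipodeHom (hc : IsCompatible q a π) (c : Fin n → K) :
    Alg q a →ₐ[K] (Alg q a)ᵐᵒᵖ :=
  RingQuot.liftAlgHom K ⟨FreeAlgebra.lift K fun i => MulOpposite.op (c i • gen q a (π i)),
    fun x y hxy => by
      cases hxy with
      | pow i =>
        simp only [map_pow, FreeAlgebra.lift_ι_apply, map_zero, ← MulOpposite.op_pow, smul_pow]
        rw [← hc.1 i, gen_pow, smul_zero, MulOpposite.op_zero]
      | comm i j =>
        simp only [map_mul, map_smul, FreeAlgebra.lift_ι_apply, ← MulOpposite.op_mul,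
          ← MulOpposite.op_smul, smul_mul_smul_comm]
        rw [gen_mul_gen (π j) (π i), hc.2, smul_smul, smul_smul]
        congr 2; ring⟩

/-- The linear endomorphism of `A(q, a)` underlying `antipodeHom`. -/
noncomputable def antipode (hc : IsCompatible q a π) (c : Fin n → K) : Alg q a →ₗ[K] Alg q a :=
  (MulOpposite.opLinearEquiv K).symm.toLinearMap ∘ₗ (antipodeHom hc c).toLinearMap

theorem antipode_gen (hc : IsCompatible q a π) (c : Fin n → K) (i : Fin n) :
    antipode hc c (gen q a i) = c i • gen q a (π i) := by
  simp only [antipode, antipodeHom, gen, LinearMap.comp_apply, AlgHom.toLinearMap_apply,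
    RingQuot.liftAlgHom_mkAlgHom_apply, FreeAlgebra.lift_ι_apply]
  rfl

theorem antipode_one (hc : IsCompatible q a π) (c : Fin n → K) : antipode hc c 1 = 1 := by
  simp [antipode]

theorem antipode_mul (hc : IsCompatible q a π) (c : Fin n → K) (x y : Alg q a) :
    antipode hc c (x * y) = antipode hc c y * antipode hc c x := by
  simp [antipode]

theorem permCoeff_eq_qc (v : Fin n → ℕ) :
    permCoeff q π v = qc (Matrix.of fun j k => qc q (act π (e k)) (act π (e j))) v v := by
  refine Finset.prod_congr rfl fun k _ => Finset.prod_congr rfl fun j _ => ?_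
  rw [Matrix.of_apply, mul_comm]

/-- `permCoeff` is the diagonal of a bimultiplicative form, so its increment is multiplicative in
`v` and the identity need only be checked on unit vectors. -/
theorem permCoeff_add_e (hq : ∀ i j, q i j * q j i = 1) (hc : IsCompatible q a π)
    (v : Fin n → ℕ) (i : Fin n) :
    permCoeff q π (v + e i) * qc q (e i) v = permCoeff q π v * qc q (act π v) (act π (e i)) := by
  set r : Matrix (Fin n) (Fin n) K :=
    Matrix.of fun j k => qc q (act π (e k)) (act π (e j)) with hr
  have key : qc r v (e i) * qc r (e i) v * qc q (e i) v = qc q (act π v) (act π (e i)) := by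
    induction v using exponent_induction with
    | zero => simp
    | add v j ih =>
      have he : qc r (e j) (e i) * qc r (e i) (e j) * qc q (e i) (e j) =
          qc q (act π (e j)) (act π (e i)) := by
        rw [qc_e_e, qc_e_e, qc_e_e]
        simp only [hr, Matrix.of_apply, act_e, qc_e_e]
        rcases lt_trichotomy i j with hij | rfl | hij
        · simp [hij, hij.not_gt]
        · simp
        · have hne : π i ≠ π j := fun h => hij.ne' (π.injective h)
          rcases hne.lt_or_gt with h | h
          · simp [hij, hij.not_gt, h, h.not_gt, hc.2]
          · simp [hij, hij.not_gt, h, h.not_gt, hc.2, hq]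
      rw [qc_add_left, qc_add_right, qc_add_right, act_add, qc_add_left, ← ih, ← he]
      ring
  rw [permCoeff_eq_qc, permCoeff_eq_qc, ← hr, ← key, qc_add_left, qc_add_right, qc_add_right,
    qc_e_e (q := r), if_neg (lt_irrefl i)]
  ring

theorem antipode_mon (hq : ∀ i j, q i j * q j i = 1)
    (hc : IsCompatible q a π) (c : Fin n → K) (v : Fin n → ℕ) :
    antipode hc c (mon q a v) = ((∏ i, c i ^ v i) * permCoeff q π v) • mon q a (act π v) := by
  induction v using exponent_induction with
  | zero => simp [antipode_one, permCoeff]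
  | add v i ih =>
    have hp : ∏ j, c j ^ (v + e i) j = (∏ j, c j ^ v j) * c i := by
      simp only [Pi.add_apply, pow_add, Finset.prod_mul_distrib]
      congr 1
      rw [Finset.prod_eq_single i] <;> simp +contextual [e]
    rw [mon_add_e hq, map_smul, antipode_mul, antipode_gen, ih, ← mon_e, ← act_e,
      smul_mul_smul_comm, mon_mul_mon hq, smul_smul, smul_smul, act_add, hp]
    congr 1
    have := permCoeff_add_e hq hc v i
    have h0 := qc_ne_zero hq (e i) v
    field_simp
    linear_combination (-(∏ j, c j ^ v j) * c i) * this

theorem antipode_antipode (hc : IsCompatible q a π) (hπ : π ^ 2 = 1) {c : Fin n → K}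
    (hcc : ∀ i, c i * c (π i) = 1) (x : Alg q a) : antipode hc c (antipode hc c x) = x := by
  induction x using Alg.induction with
  | algebraMap r => simp [Algebra.algebraMap_eq_smul_one, antipode_one]
  | gen i =>
    have : π (π i) = i := Equiv.congr_fun ((sq π).symm.trans hπ) i
    simp [antipode_gen, smul_smul, hcc, this]
  | mul x y hx hy => rw [antipode_mul, antipode_mul, hx, hy]
  | add x y hx hy => rw [map_add, map_add, hx, hy]

theorem permCoeff_top_mul_self (ha : ∀ i, a i ≠ 0) (hd : ∀ i, q i i = 1)
    (hq : ∀ i j, q i j * q j i = 1) (hc : IsCompatible q a π) (hπ : π ^ 2 = 1) :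
    permCoeff q π (top a) * permCoeff q π (top a) = 1 := by
  -- With all `c_i = 1` the antipode scales the top monomial by `permCoeff`, and its square is the
  -- identity.
  have := antipode_antipode hc hπ (c := fun _ => 1) (by simp) (mon q a (top a))
  simp only [antipode_mon hq, map_smul, act_top hc, smul_smul, one_pow, Finset.prod_const_one,
    one_mul] at this
  exact smul_left_injective K (mon_ne_zero ha hd hq le_rfl) (this.trans (one_smul K _).symm)

theorem permCoeff_top_eq_one (hq : ∀ i j, q i j * q j i = 1) (hc : IsCompatible q a π)
    (hπ : π ^ 2 = 1) (heven : ∀ i, π i = i → Even (top a i)) : permCoeff q π (top a) = 1 := by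
  have hππ : ∀ i, π (π i) = i := fun i => Equiv.congr_fun ((sq π).symm.trans hπ) i
  have htop : ∀ i, top a (π i) = top a i := fun i => by simp only [top, hc.1]
  rw [permCoeff, Finset.prod_sigma']
  -- If `π` preserves the order of `j < k`, the factors at `(j, k)` and `(π j, π k)` are inverse to
  -- each other; otherwise the factor is 1. When `π` fixes both indices, `q j k` squares to 1 and
  -- its exponent is even.
  refine Finset.prod_involution
    (fun x _ => if π x.2 < π x.1 then ⟨π x.1, π x.2⟩ else x) ?_ ?_ ?_ ?_
  · rintro ⟨k, j⟩ hx
    have hjk : j < k := by simpa using hx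
    simp only [act_e, qc_e_e]
    by_cases h : π j < π k
    · simp only [if_pos h, hππ, if_pos hjk, htop, hc.2]
      rw [← mul_pow, hq, one_pow]
    · simp [h]
  · rintro ⟨k, j⟩ hx hf heq
    refine hf ?_
    simp only [act_e, qc_e_e] at heq ⊢
    by_cases h : π j < π k
    · rw [if_pos h] at heq
      simp only [Sigma.mk.injEq, heq_eq_eq] at heq
      have h2 : q j k * q j k = 1 := by
        have := hc.2 j k
        rw [heq.1, heq.2] at this
        exact (congrArg (q j k * ·) this).trans (hq j k)
      obtain ⟨m, hm⟩ := heven j heq.2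
      rw [if_pos h, heq.1, heq.2, hm, ← two_mul, mul_assoc, pow_mul, sq, h2, one_pow]
    · simp [h]
  · rintro ⟨k, j⟩ hx
    have hjk : j < k := by simpa using hx
    by_cases h : π j < π k <;> simp [h, hjk]
  · rintro ⟨k, j⟩ hx
    have hjk : j < k := by simpa using hx
    by_cases h : π j < π k <;> simp [h, hjk, hππ]

theorem exists_antipode_scalars (ha : ∀ i, a i ≠ 0) (hd : ∀ i, q i i = 1)
    (hq : ∀ i j, q i j * q j i = 1) (hc : IsCompatible q a π) (hπ : π ^ 2 = 1) :
    ∃ c : Fin n → K, (∀ i, c i * c (π i) = 1) ∧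
      permCoeff q π (top a) * ∏ i, c i ^ (a i - 1) = 1 := by
  by_cases heven : ∀ i, π i = i → Even (top a i)
  · exact ⟨fun _ => 1, by simp, by simp [permCoeff_top_eq_one hq hc hπ heven]⟩
  · push Not at heven
    obtain ⟨i, hi, hodd⟩ := heven
    rcases mul_self_eq_one_iff.1 (permCoeff_top_mul_self ha hd hq hc hπ) with h1 | h1
    · exact ⟨fun _ => 1, by simp, by simp [h1]⟩
    -- Since `π` fixes `i`, the sign squares away in `c_i c_{π(i)}`; since `a i - 1` is odd, it
    -- survives in the product and corrects `permCoeff = -1`.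
    · refine ⟨Function.update 1 i (-1), fun j => ?_, ?_⟩
      · rcases eq_or_ne j i with rfl | hj
        · simp [hi]
        · have : π j ≠ i := fun h => hj (π.injective (h.trans hi.symm))
          simp [hj, this]
      · rw [Finset.prod_eq_single i, h1, Function.update_self,
          (Nat.not_even_iff_odd.1 hodd : Odd (a i - 1)).neg_one_pow]
        · simp
        · intro j _ hj
          simp [hj]
        · simp

end Antipode

/-! ### The explicit bi-Frobenius structure. -/

section Explicit

variable {K : Type*} [Field K] {n : ℕ} {q : Matrix (Fin n) (Fin n) K} {a : Fin n → ℕ}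
  {π : Equiv.Perm (Fin n)}

/-- The scalar by which the antipode maps `x_v` to `x_{π(v)}`. -/
def antipodeScalar (q : Matrix (Fin n) (Fin n) K) (π : Equiv.Perm (Fin n)) (c : Fin n → K)
    (v : Fin n → ℕ) : K :=
  (∏ i, c i ^ v i) * permCoeff q π v

theorem g_eq (c : Fin n → K) (v : Fin n → ℕ) :
    g q a π c v = (qc q (top a - v) v)⁻¹ * antipodeScalar q π c v := by
  rw [g, antipodeScalar, one_div, mul_assoc]

theorem antipodeScalar_zero (c : Fin n → K) : antipodeScalar q π c 0 = 1 := by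
  simp [antipodeScalar, permCoeff]

theorem antipodeScalar_mul_act (ha : ∀ i, a i ≠ 0) (hd : ∀ i, q i i = 1)
    (hq : ∀ i j, q i j * q j i = 1) (hc : IsCompatible q a π) (hπ : π ^ 2 = 1) {c : Fin n → K}
    (hcc : ∀ i, c i * c (π i) = 1) {v : Fin n → ℕ} (hv : v ≤ top a) :
    antipodeScalar q π c v * antipodeScalar q π c (act π v) = 1 := by
  have := antipode_antipode hc hπ hcc (mon q a v)
  rw [antipode_mon hq, map_smul, antipode_mon hq, act_act hπ, smul_smul] at this
  exact smul_left_injective K (mon_ne_zero ha hd hq hv) (this.trans (one_smul K _).symm)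

/-- The functional `x_{a-1}^*`. -/
noncomputable def dualTop (ha : ∀ i, a i ≠ 0) (hd : ∀ i, q i i = 1)
    (hq : ∀ i j, q i j * q j i = 1) : Module.Dual K (Alg q a) :=
  (monBasis ha hd hq).coord ⟨top a, mem_V.2 le_rfl⟩

theorem dualTop_mon (ha : ∀ i, a i ≠ 0) (hd : ∀ i, q i i = 1)
    (hq : ∀ i j, q i j * q j i = 1) (v : Fin n → ℕ) :
    dualTop ha hd hq (mon q a v) = if v = top a then 1 else 0 := by
  by_cases hv : v ≤ top a
  · have := monBasis_apply ha hd hq ⟨v, mem_V.2 hv⟩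
    simp only at this
    rw [dualTop, ← this, Module.Basis.coord_apply, Module.Basis.repr_self, Finsupp.single_apply]
    simp
  · rw [mon_eq_zero hv, map_zero, if_neg]
    rintro rfl
    exact hv le_rfl

theorem contractLeft_sum_smul_tmul {A ι : Type*} [Ring A] [Algebra K A] (f : Module.Dual K A)
    (s : Finset ι) (r : ι → K) (u w : ι → A) :
    contractLeft f (∑ i ∈ s, r i • (u i ⊗ₜ w i)) = ∑ i ∈ s, (r i * f (u i)) • w i := by
  simp [contractLeft, smul_smul]

/-- The index set of the middle terms of the comultiplication of `x_{a-1}`. -/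
def middle (a : Fin n → ℕ) : Finset (Fin n → ℕ) := ((V a).erase 0).erase (top a)

theorem mem_middle {v : Fin n → ℕ} : v ∈ middle a ↔ v ≠ top a ∧ v ≠ 0 ∧ v ≤ top a := by
  simp [middle, mem_V]

theorem top_sub_ne_zero {v : Fin n → ℕ} (hv : v ≤ top a) (h : v ≠ top a) : top a - v ≠ 0 :=
  fun h0 => h (le_antisymm hv (tsub_eq_zero_iff_le.1 h0))

theorem top_sub_ne_top {v : Fin n → ℕ} (hv : v ≤ top a) (h : v ≠ 0) : top a - v ≠ top a :=
  fun h0 => h (by rw [← tsub_tsub_cancel_of_le hv, h0, tsub_self])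

theorem top_ne_zero [NeZero n] (ha : ∀ i, 2 ≤ a i) : top a ≠ 0 := fun h => by
  have h1 := congrFun h 0
  have h2 := ha 0
  simp only [top, Pi.zero_apply] at h1
  omega

/-- The explicit coalgebra structure on `A(q, a)` attached to `π` and `c`. -/
@[reducible] noncomputable def explicitCoalgebra [NeZero n] (ha : ∀ i, 2 ≤ a i)
    (ha' : ∀ i, a i ≠ 0) (hd : ∀ i, q i i = 1) (hq : ∀ i j, q i j * q j i = 1)
    (hc : IsCompatible q a π) (c : Fin n → K) : Coalgebra K (Alg q a) :=
  almostPrimitiveCoalgebra (aug q ha').toLinearMap (dualTop ha' hd hq) (middle a)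
    (fun v => mon q a (top a - v)) (fun v => g q a π c v • mon q a (act π v))
    (by simp)
    (by rw [← mon_zero, dualTop_mon, if_neg (top_ne_zero ha).symm])
    (fun v hv => by
      obtain ⟨h1, -, h3⟩ := mem_middle.1 hv
      exact algHom_mon_eq_zero hq (aug_gen ha') (top_sub_ne_zero h3 h1))
    (fun v hv => by
      rw [map_smul, AlgHom.toLinearMap_apply, algHom_mon_eq_zero hq (aug_gen ha'), smul_zero]
      exact act_eq_zero_iff.not.2 (mem_middle.1 hv).2.1)
    (fun v hv => by
      obtain ⟨-, h2, h3⟩ := mem_middle.1 hv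
      rw [dualTop_mon, if_neg (top_sub_ne_top h3 h2)])
    (fun v hv => by
      rw [map_smul, dualTop_mon, if_neg ((act_eq_top_iff hc).not.2 (mem_middle.1 hv).1), smul_zero])

theorem isExplicitCoalgebra [NeZero n] (ha : ∀ i, 2 ≤ a i) (ha' : ∀ i, a i ≠ 0)
    (hd : ∀ i, q i i = 1) (hq : ∀ i j, q i j * q j i = 1) (hc : IsCompatible q a π) {c : Fin n → K}
    (hct : antipodeScalar q π c (top a) = 1) :
    letI := explicitCoalgebra ha ha' hd hq hc c
    IsExplicitCoalgebra q a π c := by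
  let _ := explicitCoalgebra ha ha' hd hq hc c
  have hΔ : ∀ x : Alg q a, Coalgebra.comul (R := K) x = 1 ⊗ₜ x + x ⊗ₜ 1 -
      aug q ha' x • (1 ⊗ₜ 1) + dualTop ha' hd hq x •
        ∑ v ∈ middle a, mon q a (top a - v) ⊗ₜ (g q a π c v • mon q a (act π v)) :=
    almostPrimitiveComul_apply _ _ _ _ _
  have h0 := (top_ne_zero ha).symm
  constructor
  · exact fun v _ => algHom_mon hq (aug_gen ha') v
  · rw [hΔ, map_one, ← mon_zero, dualTop_mon, if_neg h0, one_smul, zero_smul]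
    abel
  · intro v _ hv0 hvt
    rw [hΔ, algHom_mon_eq_zero hq (aug_gen ha') hv0, dualTop_mon, if_neg hvt]
    simp
  -- The terms at `v = 0` and `v = top a` are `x_{a-1} ⊗ 1` and `1 ⊗ x_{a-1}`; the second has
  -- coefficient 1 by `hct`.
  · rw [hΔ, algHom_mon_eq_zero hq (aug_gen ha') h0.symm, dualTop_mon, if_pos rfl,
      ← Finset.add_sum_erase (V a) _ (mem_V.2 (zero_le : 0 ≤ top a)),
      ← Finset.add_sum_erase ((V a).erase 0) _ (Finset.mem_erase.2 ⟨h0.symm, mem_V.2 le_rfl⟩),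
      g_eq, g_eq, antipodeScalar_zero, hct, act_top hc]
    simp only [zero_smul, one_smul, tsub_zero, tsub_self, qc_zero_left, qc_zero_right,
      mon_zero, act_zero, inv_one, mul_one, TensorProduct.tmul_smul, middle]
    abel

theorem isBiFrobenius_explicit [NeZero n] (ha : ∀ i, 2 ≤ a i) (ha' : ∀ i, a i ≠ 0)
    (hd : ∀ i, q i i = 1) (hq : ∀ i j, q i j * q j i = 1) (hA : IsSymmetricAlgebra K (Alg q a))
    (hc : IsCompatible q a π) (hπ : π ^ 2 = 1) {c : Fin n → K} (hcc : ∀ i, c i * c (π i) = 1)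
    (hct : antipodeScalar q π c (top a) = 1) :
    letI := explicitCoalgebra ha ha' hd hq hc c
    IsBiFrobenius (dualTop ha' hd hq) (mon q a (top a)) (antipode hc c) := by
  let _ := explicitCoalgebra ha ha' hd hq hc c
  have hΔ : ∀ x : Alg q a, Coalgebra.comul (R := K) x = 1 ⊗ₜ x + x ⊗ₜ 1 -
      aug q ha' x • (1 ⊗ₜ 1) + dualTop ha' hd hq x •
        ∑ v ∈ middle a, mon q a (top a - v) ⊗ₜ (g q a π c v • mon q a (act π v)) :=
    almostPrimitiveComul_apply _ _ _ _ _
  have hE : IsExplicitCoalgebra q a π c := isExplicitCoalgebra ha ha' hd hq hc hct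
  have hS : ∀ v, antipode hc c (mon q a v) = antipodeScalar q π c v • mon q a (act π v) :=
    antipode_mon hq hc c
  have hSS := antipode_antipode hc hπ hcc
  -- Complementary monomials are dual bases up to scalars; the denominator in `g` cancels these
  -- scalars.
  have hpair : ∀ u v, u ≤ top a → dualTop ha' hd hq (mon q a (top a - u) * mon q a v) =
      if u = v then qc q (top a - v) v else 0 := fun u v hu => by
    rw [mon_mul_mon hq, map_smul, dualTop_mon]
    have : top a - u + v = top a ↔ u = v := by
      conv_lhs => rhs; rw [← tsub_add_cancel_of_le hu]
      rw [add_right_inj, eq_comm]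
    simp only [this]
    split_ifs with h <;> simp [h]
  have hSeq : ∀ x, antipode hc c x = contractLeft (dualTop ha' hd hq ∘ₗ LinearMap.mulRight K x)
      (Coalgebra.comul (R := K) (mon q a (top a))) := fun x => by
    rw [hE.comul_top, contractLeft_sum_smul_tmul]
    suffices h : antipode hc c = ∑ v ∈ V a, g q a π c v •
        (dualTop ha' hd hq ∘ₗ LinearMap.mulLeft K (mon q a (top a - v))).smulRight
          (mon q a (act π v)) by
      rw [h]; simp [smul_smul]
    refine linearMap_ext_mon fun v hv => ?_
    rw [hS, LinearMap.sum_apply, Finset.sum_eq_single_of_mem v hv]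
    · have h0 := qc_ne_zero hq (top a - v) v
      simp only [LinearMap.smul_apply, LinearMap.smulRight_apply, LinearMap.comp_apply,
        LinearMap.mulLeft_apply, hpair v v (mem_V.1 hv), if_true, g_eq, smul_smul]
      field_simp
    · intro w hw hwv
      simp [hpair w v (mem_V.1 hw), hwv]
  have hεS : (aug q ha').toLinearMap ∘ₗ antipode hc c = (aug q ha').toLinearMap :=
    linearMap_ext_mon fun v _ => by
      simp only [LinearMap.comp_apply, hS, map_smul, AlgHom.toLinearMap_apply,
        algHom_mon hq (aug_gen ha'), act_eq_zero_iff]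
      split_ifs with h <;> simp [h, antipodeScalar_zero]
  have hφS : dualTop ha' hd hq ∘ₗ antipode hc c = dualTop ha' hd hq :=
    linearMap_ext_mon fun v _ => by
      simp only [LinearMap.comp_apply, hS, map_smul, dualTop_mon, act_eq_top_iff hc]
      split_ifs with h <;> simp [h, hct]
  refine
    { finite := Module.Finite.of_basis (monBasis ha' hd hq)
      antipode_eq := hSeq
      counit_one := map_one (aug q ha')
      counit_mul := map_mul (aug q ha')
      comul_one := hE.comul_one
      frobenius := fun f => ⟨∑ v ∈ V a, (f (mon q a v) / qc q v (top a - v)) •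
        mon q a (top a - v), fun x => ?_⟩
      -- As `y = S (S y)`, the functional is `z ↦ φ (z * S y)`.
      coFrobenius := fun y => ⟨_, (hSS y).symm.trans (hSeq _)⟩
      antipode_one := antipode_one hc c
      antipode_mul := antipode_mul hc c
      counit_antipode := LinearMap.congr_fun hεS
      comul_antipode := fun x => ?_ }
  · suffices h : f = dualTop ha' hd hq ∘ₗ LinearMap.mulRight K
        (∑ v ∈ V a, (f (mon q a v) / qc q v (top a - v)) • mon q a (top a - v)) from
      LinearMap.congr_fun h x
    refine linearMap_ext_mon fun v hv => ?_
    have hsub : ∀ u ∈ V a, (v + (top a - u) = top a ↔ u = v) := fun u hu => by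
      conv_lhs => rhs; rw [← add_tsub_cancel_of_le (mem_V.1 hu)]
      rw [add_left_inj, eq_comm]
    simp only [LinearMap.comp_apply, LinearMap.mulRight_apply, Finset.mul_sum, map_sum,
      mul_smul_comm, map_smul, mon_mul_mon hq, dualTop_mon]
    rw [Finset.sum_eq_single_of_mem v hv]
    · simp [hsub v hv, qc_ne_zero hq]
    · intro w hw hwv
      simp [hsub w hw, hwv]
  · have hM : TensorProduct.map (antipode hc c) (antipode hc c) (TensorProduct.comm K _ _
        (∑ v ∈ middle a, mon q a (top a - v) ⊗ₜ (g q a π c v • mon q a (act π v)))) =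
        ∑ v ∈ middle a, mon q a (top a - v) ⊗ₜ (g q a π c v • mon q a (act π v)) := by
      simp only [map_sum, TensorProduct.comm_tmul, TensorProduct.map_tmul, map_smul, hS,
        act_act hπ]
      -- The flip exchanges the terms at `v` and `a - 1 - v`. Their coefficients agree because `S² =
      -- id` and because `qc` is symmetric on complementary exponents.
      refine Finset.sum_nbij' (fun v => top a - v) (fun v => top a - v) ?_ ?_ ?_ ?_ ?_
      · intro v hv
        obtain ⟨h1, h2, h3⟩ := mem_middle.1 hv
        exact mem_middle.2 ⟨top_sub_ne_top h3 h2, top_sub_ne_zero h3 h1, tsub_le_self⟩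
      · intro v hv
        obtain ⟨h1, h2, h3⟩ := mem_middle.1 hv
        exact mem_middle.2 ⟨top_sub_ne_top h3 h2, top_sub_ne_zero h3 h1, tsub_le_self⟩
      · exact fun v hv => tsub_tsub_cancel_of_le (mem_middle.1 hv).2.2
      · exact fun v hv => tsub_tsub_cancel_of_le (mem_middle.1 hv).2.2
      · intro v hv
        have hv' := (mem_middle.1 hv).2.2
        rw [tsub_tsub_cancel_of_le hv', smul_smul, TensorProduct.smul_tmul, smul_smul]
        congr 2
        rw [g_eq, g_eq, tsub_tsub_cancel_of_le hv', qc_top_sub ha' hd hq hA hv']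
        linear_combination ((qc q v (top a - v))⁻¹ * antipodeScalar q π c (top a - v)) *
          antipodeScalar_mul_act ha' hd hq hc hπ hcc hv'
    rw [hΔ, hΔ x]
    simp only [map_add, map_sub, map_smul, hM]
    have h1 : aug q ha' (antipode hc c x) = aug q ha' x := LinearMap.congr_fun hεS x
    have h2 : dualTop ha' hd hq (antipode hc c x) = dualTop ha' hd hq x :=
      LinearMap.congr_fun hφS x
    rw [h1, h2]
    simp only [TensorProduct.comm_tmul, TensorProduct.map_tmul, antipode_one]
    abel

theorem IsExplicitAntipode.isPermutationAntipode (hc : IsCompatible q a π) (hπ : π ^ 2 = 1)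
    {c : Fin n → K} {S : Alg q a →ₗ[K] Alg q a} (hS : IsExplicitAntipode q a π c S) :
    IsPermutationAntipode q a S :=
  ⟨⟨fun v => ⟨act π v.1, mem_V.2 (act_le_top hc (mem_V.1 v.2))⟩,
    fun v => ⟨act π v.1, mem_V.2 (act_le_top hc (mem_V.1 v.2))⟩,
    fun _ => Subtype.ext (act_act hπ _), fun _ => Subtype.ext (act_act hπ _)⟩,
    fun v => antipodeScalar q π c v, fun v => hS v v.2⟩

end Explicit

/-! ### The square of the antipode of a bi-Frobenius structure on a symmetric algebra. -/

section Converse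

variable {K A : Type*} [Field K] [Ring A] [Algebra K A]

theorem apply_contractLeft_comm (f f' : Module.Dual K A) (z : A ⊗[K] A) :
    f' (contractLeft f (TensorProduct.comm K A A z)) = f (contractLeft f' z) := by
  induction z with
  | zero => simp
  | tmul x y => simp [contractLeft, mul_comm]
  | add x y hx hy => simp only [map_add, hx, hy]

theorem contractLeft_map (f : Module.Dual K A) (S : A →ₗ[K] A) (z : A ⊗[K] A) :
    contractLeft f (TensorProduct.map S S z) = S (contractLeft (f ∘ₗ S) z) := by
  induction z with
  | zero => simp
  | tmul x y => simp [contractLeft]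
  | add x y hx hy => simp only [map_add, hx, hy]

variable [Coalgebra K A]

theorem counit_contractLeft_comul (f : Module.Dual K A) (x : A) :
    Coalgebra.counit (R := K) (contractLeft f (Coalgebra.comul (R := K) x)) = f x := by
  have key : ∀ z : A ⊗[K] A, Coalgebra.counit (R := K) (contractLeft f z) =
      TensorProduct.rid K K (f.rTensor K ((Coalgebra.counit (R := K)).lTensor A z)) := by
    intro z
    induction z with
    | zero => simp
    | tmul x y => simp [contractLeft, mul_comm]
    | add x y hx hy => simp only [map_add, hx, hy]
  rw [key, Coalgebra.lTensor_counit_comul]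
  simp

variable {φ : Module.Dual K A} {t : A} {S : A →ₗ[K] A}

namespace IsBiFrobenius

/-- `S` is the composite of the two Frobenius maps `A → A^*` and `A^* → A`. -/
theorem antipode_surjective (hB : IsBiFrobenius φ t S) : Function.Surjective S := fun y => by
  obtain ⟨f, hf⟩ := hB.coFrobenius y
  obtain ⟨x, hx⟩ := hB.frobenius f
  refine ⟨x, ?_⟩
  rw [hB.antipode_eq, hf]
  congr 2
  exact LinearMap.ext fun z => (hx z).symm

theorem antipode_injective (hB : IsBiFrobenius φ t S) : Function.Injective S :=
  have := hB.finite
  LinearMap.injective_iff_surjective.2 hB.antipode_surjective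

/-- Apply the counit to `S(x) = ∑ φ(t₁ x) t₂`. -/
theorem form_mul (hB : IsBiFrobenius φ t S) (x : A) : φ (t * x) = Coalgebra.counit (R := K) x := by
  rw [← hB.counit_antipode, hB.antipode_eq, counit_contractLeft_comul]
  rfl

theorem form_self (hB : IsBiFrobenius φ t S) : φ t = 1 := by
  simpa [hB.counit_one] using hB.form_mul 1

/-- The square of the antipode of a bi-Frobenius structure on a symmetric algebra is inner. -/
theorem exists_mul_eq_mul_antipode_antipode (hB : IsBiFrobenius φ t S)
    (hA : IsSymmetricAlgebra K A) :
    ∃ u : A, Coalgebra.counit (R := K) u ≠ 0 ∧ ∀ x, x * u = u * S (S x) := by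
  obtain ⟨ψ, hψ, hrep, hnd⟩ := hA.exists_form
  have hext : ∀ x y, (∀ z, ψ (x * z) = ψ (y * z)) → x = y := fun x y hxy =>
    sub_eq_zero.1 <| hnd _ fun z => by rw [sub_mul, map_sub, hxy, sub_self]
  obtain ⟨u, hu⟩ := hrep φ
  obtain ⟨w, hw⟩ := hB.frobenius ψ
  -- `t` is a right integral, and by symmetry of `ψ` a left one. As `S` reverses products, `S t` is
  -- again a right integral, hence proportional to `t`.
  have ht1 : ∀ x, t * x = Coalgebra.counit (R := K) x • t := fun x => hext _ _ fun z => by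
    rw [hw, hw, smul_mul_assoc, smul_mul_assoc, map_smul, mul_assoc, mul_assoc, mul_assoc,
      hB.form_mul, hB.form_mul, hB.counit_mul, smul_eq_mul]
  have ht2 : ∀ x, x * t = Coalgebra.counit (R := K) x • t := fun x => hext _ _ fun z => by
    rw [mul_assoc, hψ, ht1, smul_mul_assoc, ht1, map_smul, smul_mul_assoc, ht1, map_smul, map_smul,
      map_smul, smul_comm]
  have hψt : ψ t ≠ 0 := fun h0 => by
    have : t = 0 := hnd t fun y => by rw [ht1, map_smul, h0, smul_zero]
    simpa [this] using hB.form_self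
  have hSt : ∀ z, S t * z = Coalgebra.counit (R := K) z • S t := fun z => by
    obtain ⟨x, rfl⟩ := hB.antipode_surjective z
    rw [← hB.antipode_mul, ht2, map_smul, hB.counit_antipode]
  obtain ⟨μ, hμ⟩ : ∃ μ : K, S t = μ • t := by
    refine ⟨ψ (S t) / ψ t, hext _ _ fun z => ?_⟩
    rw [hSt, smul_mul_assoc, ht1, map_smul, map_smul, map_smul, smul_eq_mul, smul_eq_mul,
      smul_eq_mul]
    field_simp
  -- Contract `Δ(S t) = ∑ S(t₂) ⊗ S(t₁)` with `φ(· y)`, cancel one `S`, and apply `φ(· x)`. Thus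
  -- `S²` is a Nakayama automorphism of `φ`, up to `μ`.
  have hN : ∀ x y, μ * φ (y * x) = φ (S (S x) * y) := fun x y => by
    have h1 := congrArg (contractLeft (φ ∘ₗ LinearMap.mulRight K y)) (hB.comul_antipode t)
    rw [hμ, map_smul, map_smul, ← hB.antipode_eq, contractLeft_map, ← map_smul] at h1
    have h2 := congrArg (φ ∘ₗ LinearMap.mulRight K x) (hB.antipode_injective h1)
    rw [apply_contractLeft_comm, ← hB.antipode_eq] at h2
    simpa using h2
  have hμ1 : μ = 1 := by
    simpa [hB.antipode_one, hB.form_self] using hN 1 t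
  refine ⟨u, fun h0 => ?_, fun x => hext _ _ fun y => ?_⟩
  · have := hu t
    rw [hB.form_self, ht1, h0, zero_smul, map_zero] at this
    exact one_ne_zero this
  · have := hN x y
    rw [hμ1, one_mul, hu, hu] at this
    -- With `φ = ψ(· u)` and `ψ` a trace form, the Nakayama identity becomes the intertwining
    -- relation for `u`.
    rw [hψ, ← mul_assoc, this, hψ (S (S x) * y) u, ← mul_assoc]

end IsBiFrobenius

end Converse

/-! ### From a permutation antipode to a compatible involution. -/

section PermutationAntipode

variable {K : Type*} [Field K] {n : ℕ} {q : Matrix (Fin n) (Fin n) K} {a : Fin n → ℕ}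

theorem leibniz_mon_eq_zero (hq : ∀ i j, q i j * q j i = 1) {ε : Alg q a →ₐ[K] K}
    (hε : ∀ i, ε (gen q a i) = 0) {D : Module.Dual K (Alg q a)}
    (hD : ∀ x y, D (x * y) = ε x * D y + D x * ε y) {v : Fin n → ℕ} (hv : v ≠ 0)
    (hve : ∀ i, v ≠ e i) : D (mon q a v) = 0 := by
  obtain ⟨w, i, rfl⟩ := exists_eq_add_e hv
  have hw : w ≠ 0 := by
    rintro rfl
    exact hve i (zero_add _)
  rw [mon_add_e hq, map_smul, hD, hε, algHom_mon_eq_zero hq hε hw]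
  simp

/-- The homomorphism to the dual numbers with `x_i ↦ ε` and `x_j ↦ 0` for `j ≠ i`. -/
noncomputable def toDualNumber (q : Matrix (Fin n) (Fin n) K) (ha : ∀ i, 2 ≤ a i) (i : Fin n) :
    Alg q a →ₐ[K] DualNumber K :=
  RingQuot.liftAlgHom K ⟨FreeAlgebra.lift K fun j => TrivSqZeroExt.inr ((e i j : ℕ) : K),
    fun x y hxy => by
      cases hxy with
      | pow j =>
        simp only [map_pow, FreeAlgebra.lift_ι_apply, map_zero]
        exact pow_eq_zero_of_le (ha j) (by rw [sq, TrivSqZeroExt.inr_mul_inr])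
      | comm j k => simp⟩

/-- The infinitesimal part of a homomorphism to the dual numbers is a derivation along its
reduction. These functionals read off linear coefficients. -/
theorem exists_leibniz (ha : ∀ i, 2 ≤ a i)
    (hq : ∀ i j, q i j * q j i = 1) {ε : Alg q a →ₐ[K] K} (hε : ∀ i, ε (gen q a i) = 0)
    (i : Fin n) : ∃ D : Module.Dual K (Alg q a), (∀ x y, D (x * y) = ε x * D y + D x * ε y) ∧
      D (gen q a i) = 1 ∧ ∀ j, j ≠ i → D (gen q a j) = 0 := by
  have hgen : ∀ j, toDualNumber q ha i (gen q a j) = TrivSqZeroExt.inr ((e i j : ℕ) : K) := fun j => by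
    rw [toDualNumber, gen, RingQuot.liftAlgHom_mkAlgHom_apply, FreeAlgebra.lift_ι_apply]
  have hfst : ∀ x, (toDualNumber q ha i x).fst = ε x := fun x => by
    let ε' : Alg q a →ₐ[K] K := (TrivSqZeroExt.fstHom K K K).comp (toDualNumber q ha i)
    have hε' : ∀ j, ε' (gen q a j) = 0 := fun j => by simp [ε', hgen]
    have : ε'.toLinearMap = ε.toLinearMap := linearMap_ext_mon fun v _ => by
      simp only [AlgHom.toLinearMap_apply, algHom_mon hq hε, algHom_mon hq hε']
    exact LinearMap.congr_fun this x
  refine ⟨(TrivSqZeroExt.sndHom K K).restrictScalars K ∘ₗ (toDualNumber q ha i).toLinearMap,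
    fun x y => ?_, ?_, fun j hj => ?_⟩
  · simp [hfst, mul_comm]
  · simp [hgen, e]
  · simp [hgen, e, hj]

theorem e_injective : Function.Injective (e : Fin n → Fin n → ℕ) := fun i j h => by
  by_contra hij
  have := congrFun h i
  simp [e, hij] at this

theorem gen_ne_zero (ha : ∀ i, 2 ≤ a i) (hd : ∀ i, q i i = 1) (hq : ∀ i j, q i j * q j i = 1)
    (i : Fin n) : gen q a i ≠ 0 := by
  rw [← mon_e]
  exact mon_ne_zero (fun i => by have := ha i; omega) hd hq (e_le_top ha i)

theorem gen_mul_gen_ne_zero (ha : ∀ i, 2 ≤ a i) (hd : ∀ i, q i i = 1)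
    (hq : ∀ i j, q i j * q j i = 1) {i j : Fin n} (hij : i ≠ j) :
    gen q a i * gen q a j ≠ 0 := by
  rw [← mon_e, ← mon_e, mon_mul_mon hq]
  refine smul_ne_zero (qc_ne_zero hq _ _)
    (mon_ne_zero (fun i => by have := ha i; omega) hd hq fun k => ?_)
  have := ha k
  rcases eq_or_ne k i with rfl | hk
  · simp [e, top, hij]; omega
  · simp only [e, top, Pi.add_apply, Pi.single_eq_of_ne hk, zero_add, Pi.single_apply]
    split_ifs <;> omega

theorem gen_pow_ne_zero (ha : ∀ i, a i ≠ 0) (hd : ∀ i, q i i = 1)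
    (hq : ∀ i j, q i j * q j i = 1) {i : Fin n} {k : ℕ} (hk : k < a i) :
    gen q a i ^ k ≠ 0 := by
  obtain ⟨r, hr, h⟩ : ∃ r : K, r ≠ 0 ∧ gen q a i ^ k = r • mon q a (k • e i) := by
    clear hk
    induction k with
    | zero => exact ⟨1, one_ne_zero, by simp⟩
    | succ k ih =>
      obtain ⟨r, hr, h⟩ := ih
      refine ⟨r * qc q (e i) (k • e i), mul_ne_zero hr (qc_ne_zero hq _ _), ?_⟩
      rw [pow_succ', h, mul_smul_comm, gen_mul_mon, smul_smul, succ_nsmul]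
  rw [h]
  refine smul_ne_zero hr (mon_ne_zero ha hd hq fun j => ?_)
  rcases eq_or_ne j i with rfl | hj
  · simp [e, top]; omega
  · simp [e, hj]

theorem exists_compatible_of_admits (ha : ∀ i, 2 ≤ a i) (hd : ∀ i, q i i = 1)
    (hq : ∀ i j, q i j * q j i = 1) (hA : IsSymmetricAlgebra K (Alg q a))
    (hB : AdmitsPermutationBiFrobenius q a) :
    ∃ π : Equiv.Perm (Fin n), IsCompatible q a π ∧ π ^ 2 = 1 := by
  obtain ⟨_, φ, t, S, hB, σ, c, hσ⟩ := hB
  have ha' : ∀ i, a i ≠ 0 := fun i => by have := ha i; omega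
  let ε : Alg q a →ₐ[K] K :=
    AlgHom.ofLinearMap (Coalgebra.counit (R := K)) hB.counit_one hB.counit_mul
  -- The coalgebra is arbitrary, but its counit must kill nilpotent elements.
  have hε : ∀ i, ε (gen q a i) = 0 := fun i => by
    have : ε (gen q a i) ^ a i = 0 := by rw [← map_pow, gen_pow, map_zero]
    exact pow_eq_zero_iff (ha' i) |>.1 this
  have hεS : ∀ x, ε (S x) = ε x := hB.counit_antipode
  choose D hDL hD1 hD0 using exists_leibniz ha hq hε
  let S' : Alg q a ≃ₗ[K] Alg q a :=
    LinearEquiv.ofBijective S ⟨hB.antipode_injective, hB.antipode_surjective⟩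
  have hS' : ∀ x, S (S'.symm x) = x := S'.apply_symm_apply
  have hS'' : ∀ x, S'.symm (S x) = x := S'.symm_apply_apply
  let E : Fin n → V a := fun i => ⟨e i, mem_V.2 (e_le_top ha i)⟩
  have hSgen : ∀ i, S (gen q a i) = c (E i) • mon q a (σ (E i)) := fun i => by
    rw [← hσ, ← mon_e]
  have hc : ∀ i, c (E i) ≠ 0 := fun i h0 => gen_ne_zero ha hd hq i <| hB.antipode_injective <| by
    rw [hSgen, h0, zero_smul, map_zero]
  have hex : ∀ i, ∃ j, (σ (E i) : Fin n → ℕ) = e j := fun i => by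
    by_contra! hne
    have hne0 : (σ (E i) : Fin n → ℕ) ≠ 0 := fun h0 => by
      have := hεS (gen q a i)
      rw [hSgen, h0, map_smul, hε, mon_zero, map_one, smul_eq_mul, mul_one] at this
      exact hc i this
    -- Precomposing with the inverse of `S` keeps the Leibniz rule, as the values commute. Such a
    -- functional kills every nonconstant monomial other than a generator, yet takes the value 1 at
    -- `S(x_i)`.
    have hL : ∀ x y, (D i ∘ₗ S'.symm.toLinearMap) (x * y) =
        ε x * (D i ∘ₗ S'.symm.toLinearMap) y + (D i ∘ₗ S'.symm.toLinearMap) x * ε y := fun x y => by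
      have h1 : S'.symm (x * y) = S'.symm y * S'.symm x := hB.antipode_injective <| by
        rw [hB.antipode_mul, hS', hS', hS']
      have h2 : ∀ z, ε (S'.symm z) = ε z := fun z => by rw [← hεS, hS']
      simp only [LinearMap.comp_apply, LinearEquiv.coe_coe, h1, hDL, h2]
      ring
    have h1 := leibniz_mon_eq_zero hq hε hL hne0 hne
    have h2 : (D i ∘ₗ S'.symm.toLinearMap) (S (gen q a i)) = 1 := by
      simp [hS'', hD1]
    rw [hSgen, map_smul, h1, smul_zero] at h2
    exact zero_ne_one h2
  choose p hp using hex
  have hpinj : Function.Injective p := fun i j hij => by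
    have h1 : σ (E i) = σ (E j) := Subtype.ext (by rw [hp, hp, hij])
    exact e_injective (congrArg Subtype.val (σ.injective h1))
  let π : Equiv.Perm (Fin n) := Equiv.ofBijective p (Finite.injective_iff_bijective.1 hpinj)
  have hSp : ∀ i, S (gen q a i) = c (E i) • gen q a (π i) := fun i => by
    rw [hSgen, hp, mon_e]; rfl
  have hSpow : ∀ i k, S (gen q a i ^ k) = c (E i) ^ k • gen q a (π i) ^ k := fun i k => by
    rw [← smul_pow, ← hSp]
    induction k with
    | zero => simp [hB.antipode_one]
    | succ k ih => rw [pow_succ, hB.antipode_mul, ih, pow_succ']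
  -- `x_i` and `x_{π(i)}` have the same nilpotency order; applying `S` to a commutation relation and
  -- comparing it with the relation of the images gives the condition on `q`.
  refine ⟨π, ⟨fun i => le_antisymm ?_ ?_, fun i j => ?_⟩, ?_⟩
  · by_contra! hlt
    have := hSpow i (a i)
    rw [gen_pow, map_zero] at this
    exact smul_ne_zero (pow_ne_zero _ (hc i)) (gen_pow_ne_zero ha' hd hq hlt) this.symm
  · by_contra! hlt
    have := hSpow i (a (π i))
    rw [gen_pow, smul_zero] at this
    exact gen_pow_ne_zero ha' hd hq hlt (hB.antipode_injective (this.trans (map_zero S).symm))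
  · rcases eq_or_ne i j with rfl | hij
    · rw [hd, hd]
    · have h1 := congrArg S (gen_mul_gen (q := q) (a := a) j i)
      rw [map_smul, hB.antipode_mul, hB.antipode_mul, hSp, hSp, smul_mul_smul_comm,
        smul_mul_smul_comm, gen_mul_gen (π i) (π j), smul_smul, smul_smul] at h1
      have h2 := smul_left_injective K
        (gen_mul_gen_ne_zero ha hd hq (fun h => hij (π.injective h))) h1
      refine mul_left_cancel₀ (mul_ne_zero (hc i) (hc j)) ?_
      linear_combination h2
  · obtain ⟨u, hu0, hu⟩ := hB.exists_mul_eq_mul_antipode_antipode hA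
    ext1 i
    -- The linear coefficient at `x_i` is `ε(u) ≠ 0` on the left, but on the right it vanishes
    -- unless `π (π i) = i`.
    have h1 := congrArg (D i) (hu (gen q a i))
    rw [hDL, hDL, hεS, hεS, hε, hD1, zero_mul, zero_add, one_mul, mul_zero, add_zero, hSp, map_smul,
      hSp, map_smul, map_smul] at h1
    by_contra hne
    rw [hD0 i (π (π i)) (by simpa [sq] using hne)] at h1
    simp only [smul_zero, mul_zero] at h1
    exact hu0 h1

end PermutationAntipode

end QuantumCI

theorem theorem6p3 {K : Type*} [Field K] {n : ℕ} (hn : 2 ≤ n)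
    (q : Matrix (Fin n) (Fin n) K) (a : Fin n → ℕ) (ha : ∀ i, 2 ≤ a i)
    (hq_diag : ∀ i, q i i = 1) (hq_inv : ∀ i j, q i j * q j i = 1)
    (hsymm : QuantumCI.IsSymmetricAlgebra K (QuantumCI.Alg q a)) :
    (QuantumCI.AdmitsPermutationBiFrobenius q a ↔
      ∃ π : Equiv.Perm (Fin n), QuantumCI.IsCompatible q a π ∧ π ^ 2 = 1) ∧
    ∀ π : Equiv.Perm (Fin n), QuantumCI.IsCompatible q a π → π ^ 2 = 1 →
      ∃ c : Fin n → K,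
        (∀ i, c i * c (π i) = QuantumCI.h q a (QuantumCI.e i)) ∧
        QuantumCI.permCoeff q π (QuantumCI.top a) * ∏ i, c i ^ (a i - 1) = 1 ∧
        ∃ (_ : Coalgebra K (QuantumCI.Alg q a)) (φ : Module.Dual K (QuantumCI.Alg q a))
          (S : QuantumCI.Alg q a →ₗ[K] QuantumCI.Alg q a),
          QuantumCI.IsDualTop q a φ ∧
          QuantumCI.IsExplicitCoalgebra q a π c ∧
          QuantumCI.IsExplicitAntipode q a π c S ∧
          (∀ i, S (QuantumCI.gen q a i) = c i • QuantumCI.gen q a (π i)) ∧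
          QuantumCI.IsBiFrobenius φ (QuantumCI.mon q a (QuantumCI.top a)) S := by
  have : NeZero n := ⟨by omega⟩
  have ha' : ∀ i, a i ≠ 0 := fun i => by have := ha i; omega
  have explicit : ∀ π : Equiv.Perm (Fin n), QuantumCI.IsCompatible q a π → π ^ 2 = 1 →
      ∃ c : Fin n → K,
        (∀ i, c i * c (π i) = QuantumCI.h q a (QuantumCI.e i)) ∧
        QuantumCI.permCoeff q π (QuantumCI.top a) * ∏ i, c i ^ (a i - 1) = 1 ∧
        ∃ (_ : Coalgebra K (QuantumCI.Alg q a)) (φ : Module.Dual K (QuantumCI.Alg q a))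
          (S : QuantumCI.Alg q a →ₗ[K] QuantumCI.Alg q a),
          QuantumCI.IsDualTop q a φ ∧
          QuantumCI.IsExplicitCoalgebra q a π c ∧
          QuantumCI.IsExplicitAntipode q a π c S ∧
          (∀ i, S (QuantumCI.gen q a i) = c i • QuantumCI.gen q a (π i)) ∧
          QuantumCI.IsBiFrobenius φ (QuantumCI.mon q a (QuantumCI.top a)) S := by
    intro π hc hπ
    obtain ⟨c, hcc, hct⟩ := QuantumCI.exists_antipode_scalars ha' hq_diag hq_inv hc hπ
    have hct' : QuantumCI.antipodeScalar q π c (QuantumCI.top a) = 1 := by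
      rw [← hct, mul_comm]; rfl
    exact ⟨c, fun i => by
        rw [hcc, QuantumCI.h_eq_one ha' hq_diag hq_inv hsymm (QuantumCI.e_le_top ha i)], hct,
      QuantumCI.explicitCoalgebra ha ha' hq_diag hq_inv hc c,
      QuantumCI.dualTop ha' hq_diag hq_inv, QuantumCI.antipode hc c,
      fun v _ => QuantumCI.dualTop_mon ha' hq_diag hq_inv v,
      QuantumCI.isExplicitCoalgebra ha ha' hq_diag hq_inv hc hct',
      fun v _ => QuantumCI.antipode_mon hq_inv hc c v, QuantumCI.antipode_gen hc c,
      QuantumCI.isBiFrobenius_explicit ha ha' hq_diag hq_inv hsymm hc hπ hcc hct'⟩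
  refine ⟨⟨QuantumCI.exists_compatible_of_admits ha hq_diag hq_inv hsymm, ?_⟩, explicit⟩
  rintro ⟨π, hc, hπ⟩
  obtain ⟨c, -, -, C, φ, S, -, -, hS, -, hB⟩ := explicit π hc hπ
  exact ⟨C, φ, _, S, hB, hS.isPermutationAntipode hc hπ⟩
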